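/- Let $\lambda,\mu>0$ with $\lambda\neq\mu$, $\alpha\in(0,1]$ and $i\in\{0,1,2,\dots\}$. Let $N^\alpha(t)$, $t\ge 0$, be a fractional M/M/1 queue with arrival rate $\lambda$, service rate $\mu$ and $i$ initial customers, i.e. a process with values in $\{0,1,2,\dots\}$ with $\Pr\{N^\alpha(0)=i\}>0$ whose state probabilities $p_k^\alpha(t)=\Pr\{N^\alpha(t)=k\mid N^\alpha(0)=i\}$ are continuous on $[0,\infty)$ and satisfy $$ \begin{cases} D_t^\alpha p_k^\alpha(t)=-(\lambda+\mu)p_k^\alpha(t)+\lambda p_{k-1}^\alpha(t)+\mu p_{k+1}^\alpha(t), & k\ge 1,\ t>0,\\ D_t^\alpha p_0^\alpha(t)=-\lambda p_0^\alpha(t)+\mu p_1^\alpha(t), & t>0,\\ p_k^\alpha(0)=\delta_{k,i}, & k\ge 0. \end{cases} $$ Here $D_t^\alpha$ is the Caputo derivative: $D_t^1=\frac{\mathrm d}{\mathrm dt}$ and, for $0<\alpha<1$, $D_t^\alpha f(t)=\frac{1}{\Gamma(1-\alpha)}\frac{\mathrm d}{\mathrm dt}\int_0^t (t-s)^{-\alpha}\,[f(s)-f(0)]\,\mathrm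 ds$. For $\beta>0$ and real $\gamma,\delta,w$ let $$E_{\beta,\gamma}^{\delta}(w)=\sum_{r=0}^\infty\frac{(\delta)_r\,w^r}{r!\,\Gamma(\beta r+\gamma)},\qquad (\delta)_r=\delta(\delta+1)\cdots(\delta+r-1),$$ be the generalized (three-parameter, Prabhakar) Mittag-Leffler function. Then, for all $k\ge 0$ and $t\ge 0$, both series over $r$ below converge absolutely and $$ \begin{aligned} p_k^\alpha(t)={}&\Bigl(1-\frac{\lambda}{\mu}\Bigr)\Bigl(\frac{\lambda}{\mu}\Bigr)^k\\ &+\Bigl(\frac{\lambda}{\mu}\Bigr)^k\sum_{r=0}^\infty\sum_{m=0}^{k+r+i}\frac{r-m}{r+m}\binom{r+m}{r}\lambda^r\mu^{m-1}t^{\alpha(r+m)-\alpha}E_{\alpha,\alpha(r+m)-\alpha+1}^{\,r+m}\bigl[-(\lambda+\mu)t^\alpha\bigr]\\ &+\sum_{r=0}^\infty\left[\binom{k+2r-i}{r}-\binom{k+2r-i}{k+r}\right]\lambda^{k+r-i}\mu^r t^{\alpha(k+2r-i)}E_{\alpha,\alpha(k+2r-i)+1}^{\,k+2r-i+1}\bigl[-(\lambda+\mu)t^\alpha\bigr].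 \end{aligned} $$ Conventions: the term with $r=m=0$ of the double series is $0$; $\binom{n}{j}=0$ if $n<0$ or $j>n$, and terms of the last series with vanishing bracket are $0$; $0^0=1$. -/

import Mathlib

open MeasureTheory ProbabilityTheory Set
open scoped NNReal

/-- The Riemann--Liouville fractional integral of order `β > 0`,
`J^β f (t) = Γ(β)⁻¹ ∫₀ᵗ (t - s)^(β - 1) f(s) ds`. -/
noncomputable def rlIntegral (β : ℝ) (f : ℝ → ℝ) (t : ℝ) : ℝ :=
  (1 / Real.Gamma β) * ∫ s in (0 : ℝ)..t, (t - s) ^ (β - 1) * f s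

/-- `HasCaputoDerivAt α f d t`: the Caputo derivative of order `α ∈ (0, 1]` of `f` at the time
`t > 0` exists and equals `d`. For `α = 1` it is the ordinary derivative; for `0 < α < 1` it is
`D^α f (t) = d/dt J^(1 - α) [f - f(0)] (t)`, which for absolutely continuous `f` is the same as
`J^(1 - α) [f'] (t)`. -/
def HasCaputoDerivAt (α : ℝ) (f : ℝ → ℝ) (d t : ℝ) : Prop :=
  if α = 1 then HasDerivAt f d t
  else HasDerivAt (rlIntegral (1 - α) (fun s => f s - f 0)) d t

/-- The state probabilities `p_k(t) = Pr {N(t) = k | N(0) = i}` of a process `N` in `ℕ`. Only the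
values at times `t ≥ 0` matter. -/
noncomputable def stateProb {Ω : Type*} [MeasurableSpace Ω] (P : Measure Ω) (N : ℝ≥0 → Ω → ℕ)
    (i k : ℕ) (t : ℝ) : ℝ :=
  (ProbabilityTheory.cond P {ω | N 0 ω = i}).real {ω | N t.toNNReal ω = k}

/-- `N` is a fractional M/M/1 queue of order `α` with arrival rate `lam`, service rate `mu` and
`i` initial customers: its state probabilities, given `N(0) = i`, solve the Cauchy problem for
the difference-differential equations with the Caputo time derivative. -/
structure IsFractionalMM1Queue {Ω : Type*} [MeasurableSpace Ω] (α lam mu : ℝ) (i : ℕ)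
    (P : Measure Ω) (N : ℝ≥0 → Ω → ℕ) : Prop where
  measurable : ∀ t, Measurable (N t)
  /-- The conditioning on `N(0) = i` makes sense. -/
  start : P {ω | N 0 ω = i} ≠ 0
  continuousOn : ∀ k, ContinuousOn (stateProb P N i k) (Ici 0)
  init : ∀ k, stateProb P N i k 0 = if k = i then 1 else 0
  eq_zero : ∀ t, 0 < t →
    HasCaputoDerivAt α (stateProb P N i 0)
      (-lam * stateProb P N i 0 t + mu * stateProb P N i 1 t) t
  eq_succ : ∀ k, 1 ≤ k → ∀ t, 0 < t →
    HasCaputoDerivAt α (stateProb P N i k)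
      (-(lam + mu) * stateProb P N i k t + lam * stateProb P N i (k - 1) t
        + mu * stateProb P N i (k + 1) t) t

/-- The generalized (three-parameter, Prabhakar) Mittag-Leffler function
`E^δ_{β,γ}(w) = ∑ r, (δ)_r w^r / (r! Γ(β r + γ))`, for `β > 0` and real `γ`, `δ`, `w`. Here
`(δ)_r = δ (δ + 1) ⋯ (δ + r - 1)`, and `1 / Γ` vanishes at the poles of `Γ`, as it should, since
Mathlib gives `Γ` the value `0` there. -/
noncomputable def prabhakar (β γ δ w : ℝ) : ℝ :=
  ∑' r : ℕ, (ascPochhammer ℝ r).eval δ * w ^ r / (r.factorial * Real.Gamma (β * r + γ))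

/-- The binomial coefficient `n! / (j! (n - j)!)` for integer `n` and `j ≥ 0`, which is `0` when
`n < 0` or `j > n`. -/
def intChoose (n : ℤ) (j : ℕ) : ℕ :=
  if n < 0 then 0 else n.toNat.choose j

/-- The `(r, m)` term of the double series. Its factor `(r - m) / (r + m)` is `0` at
`r = m = 0`. -/
noncomputable def doubleTerm (α lam mu t : ℝ) (r m : ℕ) : ℝ :=
  ((r : ℝ) - m) / ((r : ℝ) + m) * ((r + m).choose r : ℝ) * lam ^ r * mu ^ ((m : ℤ) - 1)
    * t ^ (α * ((r : ℝ) + m) - α)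
    * prabhakar α (α * ((r : ℝ) + m) - α + 1) ((r : ℝ) + m) (-(lam + mu) * t ^ α)

/-- The `r`-th term of the single series. -/
noncomputable def singleTerm (α lam mu t : ℝ) (i k r : ℕ) : ℝ :=
  ((intChoose ((k : ℤ) + 2 * r - i) r : ℝ) - (intChoose ((k : ℤ) + 2 * r - i) (k + r) : ℝ))
    * lam ^ ((k : ℤ) + r - i) * mu ^ r
    * t ^ (α * ((k : ℝ) + 2 * r - i))
    * prabhakar α (α * ((k : ℝ) + 2 * r - i) + 1) ((k : ℝ) + 2 * r - i + 1)
        (-(lam + mu) * t ^ α)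

/-!
Put `c = lam + mu`, `ρ = lam / mu` and `mlTerm α t N = t ^ (α N) / Γ(α N + 1)`. The proof is a
comparison of coefficients in power series in `t ^ α`; no Laplace transform is needed.

A Caputo equation with continuous data is a Volterra equation
(`eq_add_rlIntegral_of_hasCaputoDerivAt`, from the semigroup law `rlIntegral_rlIntegral`). The
generator of the queue is bounded on bounded sequences, so Picard iteration converges and forces
`p_k(t) = ∑ N, (generator ^ N e_i)_k * mlTerm α t N` (`tendsto_stateProb`). In particular the
solution is unique.

Write the generator as `jump - c`. Expanding its powers binomially and interchanging the sums gives
`p_k(t) = ∑ n, (jump ^ n e_i)_k * poissonML α c t n` (`hasSum_jump_pow_mul_poissonML`), where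
`poissonML α c t n` is `t ^ (α n)` times the Prabhakar function with parameters
`(α, α n + 1, n + 1)` at `-c t ^ α` (`rpow_mul_prabhakar`). This is the only transcendental factor
in either series of the formula.

What remains is combinatorial. `jump` is the weighted step operator of a walk on `ℕ` with steps
`+1` (weight `lam`), `-1` (weight `mu`), and a loop of weight `mu` at `0`. The walks from `i` to `k`
that avoid `0` are counted by the reflection principle (`walkPart`, giving the single series), and
those that visit `0` have total weight `ρ ^ k` times a truncated sum of ballot numbers
(`boundaryPart`, giving the double series and, because `∑ n, c ^ n * poissonML α c t n = 1`, the
constant term). The resulting identity `jump_pow_apply` is proved by induction on `n`.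
-/

/-! ### The Riemann--Liouville integral -/

theorem real_betaIntegral_scaled {a b t : ℝ} (ha : 0 < a) (hb : 0 < b) (ht : 0 < t) :
    ∫ s in (0 : ℝ)..t, s ^ (a - 1) * (t - s) ^ (b - 1) = t ^ (a + b - 1) * beta a b := by
  have h := Complex.betaIntegral_scaled (a : ℂ) (b : ℂ) ht
  have h1 : ∫ s in (0 : ℝ)..t, (s : ℂ) ^ ((a : ℂ) - 1) * ((t : ℂ) - s) ^ ((b : ℂ) - 1)
      = ((∫ s in (0 : ℝ)..t, s ^ (a - 1) * (t - s) ^ (b - 1) : ℝ) : ℂ) := by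
    rw [← intervalIntegral.integral_ofReal]
    refine intervalIntegral.integral_congr fun s hs => ?_
    rw [uIcc_of_le ht.le] at hs
    push_cast [Complex.ofReal_cpow hs.1, Complex.ofReal_cpow (sub_nonneg.2 hs.2)]
    rfl
  have h2 : (t : ℂ) ^ ((a : ℂ) + b - 1) = ((t ^ (a + b - 1) : ℝ) : ℂ) := by
    push_cast [Complex.ofReal_cpow ht.le]
    rfl
  rw [h1, h2] at h
  have h3 := congrArg Complex.re h
  rwa [Complex.ofReal_re, Complex.re_ofReal_mul, ← beta_eq_betaIntegralReal a b ha hb] at h3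

theorem rlIntegral_zero (b : ℝ) (f : ℝ → ℝ) : rlIntegral b f 0 = 0 := by
  simp [rlIntegral]

theorem rlIntegral_rpow {b q t : ℝ} (hb : 0 < b) (hq : 0 ≤ q) (ht : 0 ≤ t) :
    rlIntegral b (fun s => s ^ q) t
      = Real.Gamma (q + 1) / Real.Gamma (q + b + 1) * t ^ (q + b) := by
  rcases ht.eq_or_lt with rfl | ht
  · rw [rlIntegral_zero, Real.zero_rpow (by positivity), mul_zero]
  have h := real_betaIntegral_scaled (a := q + 1) (by positivity) hb ht
  have h0 := (Real.Gamma_pos_of_pos hb).ne'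
  simp only [add_sub_cancel_right] at h
  rw [rlIntegral]
  simp_rw [mul_comm _ (_ ^ q)]
  rw [h, beta, show q + 1 + b - 1 = q + b by ring, show q + 1 + b = q + b + 1 by ring]
  field_simp

theorem intervalIntegrable_rlKernel {b t : ℝ} (hb : 0 < b) :
    IntervalIntegrable (fun s => (t - s) ^ (b - 1)) volume 0 t := by
  have h := (intervalIntegral.intervalIntegrable_rpow' (a := 0) (b := t)
    (show -1 < b - 1 by linarith)).comp_sub_left t
  simpa using h.symm

theorem intervalIntegrable_rlIntegrand {b t : ℝ} {f : ℝ → ℝ} (hb : 0 < b) (ht : 0 ≤ t)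
    (hf : ContinuousOn f (Icc 0 t)) :
    IntervalIntegrable (fun s => (t - s) ^ (b - 1) * f s) volume 0 t :=
  (intervalIntegrable_rlKernel hb).mul_continuousOn (by rwa [uIcc_of_le ht])

theorem rlIntegral_congr {b t : ℝ} {f g : ℝ → ℝ} (ht : 0 ≤ t) (h : EqOn f g (Icc 0 t)) :
    rlIntegral b f t = rlIntegral b g t := by
  rw [rlIntegral, rlIntegral]
  congr 1
  refine intervalIntegral.integral_congr fun s hs => ?_
  rw [uIcc_of_le ht] at hs
  simp only [h hs]

theorem rlIntegral_sub {b t : ℝ} {f g : ℝ → ℝ} (hb : 0 < b) (ht : 0 ≤ t)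
    (hf : ContinuousOn f (Icc 0 t)) (hg : ContinuousOn g (Icc 0 t)) :
    rlIntegral b (fun s => f s - g s) t = rlIntegral b f t - rlIntegral b g t := by
  rw [rlIntegral, rlIntegral, rlIntegral, ← mul_sub, ← intervalIntegral.integral_sub
    (intervalIntegrable_rlIntegrand hb ht hf) (intervalIntegrable_rlIntegrand hb ht hg)]
  simp_rw [mul_sub]

theorem rlIntegral_const_mul (b t c : ℝ) (f : ℝ → ℝ) :
    rlIntegral b (fun s => c * f s) t = c * rlIntegral b f t := by
  simp only [rlIntegral, mul_left_comm _ c, intervalIntegral.integral_const_mul]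

theorem rlIntegral_sum {ι : Type*} {b t : ℝ} (u : Finset ι) {f : ι → ℝ → ℝ} (hb : 0 < b)
    (ht : 0 ≤ t) (hf : ∀ j ∈ u, ContinuousOn (f j) (Icc 0 t)) :
    rlIntegral b (fun s => ∑ j ∈ u, f j s) t = ∑ j ∈ u, rlIntegral b (f j) t := by
  simp only [rlIntegral, ← Finset.mul_sum]
  rw [← intervalIntegral.integral_finsetSum
    fun j hj => intervalIntegrable_rlIntegrand hb ht (hf j hj)]
  simp_rw [Finset.mul_sum]

theorem abs_rlIntegral_le {b t : ℝ} {f g : ℝ → ℝ} (hb : 0 < b) (ht : 0 ≤ t)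
    (hg : ContinuousOn g (Icc 0 t)) (h : ∀ s ∈ Icc 0 t, |f s| ≤ g s) :
    |rlIntegral b f t| ≤ rlIntegral b g t := by
  have h0 : 0 < 1 / Real.Gamma b := one_div_pos.2 (Real.Gamma_pos_of_pos hb)
  rw [rlIntegral, rlIntegral, abs_mul, abs_of_pos h0]
  refine mul_le_mul_of_nonneg_left ?_ h0.le
  rw [← Real.norm_eq_abs]
  refine intervalIntegral.norm_integral_le_of_norm_le ht (ae_of_all _ fun s hs => ?_)
    (intervalIntegrable_rlIntegrand hb ht hg)
  rw [norm_mul, Real.norm_of_nonneg (Real.rpow_nonneg (sub_nonneg.2 hs.2) _)]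
  exact mul_le_mul_of_nonneg_left (h s ⟨hs.1.le, hs.2⟩)
    (Real.rpow_nonneg (sub_nonneg.2 hs.2) _)

theorem rlIntegral_const {b t : ℝ} (c : ℝ) (hb : 0 < b) (ht : 0 ≤ t) :
    rlIntegral b (fun _ => c) t = c / Real.Gamma (b + 1) * t ^ b := by
  have h := rlIntegral_rpow hb le_rfl ht
  simp only [Real.rpow_zero, zero_add, Real.Gamma_one] at h
  have h2 := rlIntegral_const_mul b t c (fun _ => (1 : ℝ))
  rw [h] at h2
  simp only [mul_one] at h2
  rw [h2]
  ring

theorem rlIntegral_polynomial {b t : ℝ} (hb : 0 < b) (ht : 0 ≤ t) (p : Polynomial ℝ) :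
    rlIntegral b (fun s => p.eval s) t = ∑ n ∈ Finset.range (p.natDegree + 1),
      p.coeff n * (Real.Gamma (n + 1) / Real.Gamma (n + b + 1) * t ^ (n + b)) := by
  simp_rw [Polynomial.eval_eq_sum_range]
  rw [rlIntegral_sum _ hb ht fun n _ => by fun_prop]
  refine Finset.sum_congr rfl fun n _ => ?_
  rw [rlIntegral_const_mul]
  simp_rw [← Real.rpow_natCast]
  rw [rlIntegral_rpow hb (Nat.cast_nonneg n) ht]

theorem abs_rlIntegral_sub_le {b t ε : ℝ} {f g : ℝ → ℝ} (hb : 0 < b) (ht : 0 ≤ t)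
    (hf : ContinuousOn f (Icc 0 t)) (hg : ContinuousOn g (Icc 0 t))
    (h : ∀ s ∈ Icc 0 t, |f s - g s| ≤ ε) :
    |rlIntegral b f t - rlIntegral b g t| ≤ ε / Real.Gamma (b + 1) * t ^ b := by
  rw [← rlIntegral_sub hb ht hf hg, ← rlIntegral_const ε hb ht]
  exact abs_rlIntegral_le hb ht continuousOn_const h

/-- `J^b f` is a uniform limit of `J^b p` for polynomials `p`, which are finite sums of powers. -/
theorem continuousOn_rlIntegral_Icc {b T : ℝ} {f : ℝ → ℝ} (hb : 0 < b)
    (hf : ContinuousOn f (Icc 0 T)) : ContinuousOn (rlIntegral b f) (Icc 0 T) := by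
  refine continuousOn_of_uniform_approx_of_continuousOn fun u hu => ?_
  obtain ⟨ε, hε, hu⟩ := Metric.mem_uniformity_dist.1 hu
  have hG := Real.Gamma_pos_of_pos (show 0 < b + 1 by positivity)
  rcases lt_or_ge T 0 with hT | hT
  · exact ⟨0, by fun_prop, fun y hy => absurd (hy.1.trans hy.2) (not_le.2 hT)⟩
  have hK : 0 < T ^ b / Real.Gamma (b + 1) + 1 := by positivity
  obtain ⟨p, hp⟩ := exists_polynomial_near_of_continuousOn 0 T f hf
    (ε / (T ^ b / Real.Gamma (b + 1) + 1)) (by positivity)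
  refine ⟨fun t => ∑ n ∈ Finset.range (p.natDegree + 1),
    p.coeff n * (Real.Gamma (n + 1) / Real.Gamma (n + b + 1) * t ^ (n + b)), ?_, fun t ht => hu ?_⟩
  · exact (continuous_finsetSum _ fun n _ => continuous_const.mul (continuous_const.mul
      (Real.continuous_rpow_const (by positivity)))).continuousOn
  beta_reduce
  rw [Real.dist_eq, ← rlIntegral_polynomial hb ht.1]
  have hsub : Icc 0 t ⊆ Icc 0 T := Icc_subset_Icc_right ht.2
  refine (abs_rlIntegral_sub_le hb ht.1 (hf.mono hsub) (by fun_prop)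
    (fun s hs => (abs_sub_comm (f s) _).trans_le (hp s (hsub hs)).le)).trans_lt ?_
  have h1 : t ^ b ≤ T ^ b := Real.rpow_le_rpow ht.1 ht.2 hb.le
  calc _ ≤ ε / (T ^ b / Real.Gamma (b + 1) + 1) / Real.Gamma (b + 1) * T ^ b := by gcongr
    _ = ε * ((T ^ b / Real.Gamma (b + 1)) / (T ^ b / Real.Gamma (b + 1) + 1)) := by ring
    _ < ε * 1 := by
      gcongr
      rw [div_lt_one hK]
      linarith
    _ = ε := mul_one ε

theorem continuousOn_rlIntegral {b : ℝ} {f : ℝ → ℝ} (hb : 0 < b)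
    (hf : ContinuousOn f (Ici 0)) : ContinuousOn (rlIntegral b f) (Ici 0) := by
  intro t ht
  have h := continuousOn_rlIntegral_Icc (T := t + 1) hb (hf.mono Icc_subset_Ici_self)
  refine (h t ⟨ht, by linarith⟩).mono_of_mem_nhdsWithin ?_
  rw [← Ici_inter_Iic]
  exact Filter.inter_mem self_mem_nhdsWithin
    (mem_nhdsWithin_of_mem_nhds (Iic_mem_nhds (by linarith)))

theorem rlIntegral_rlIntegral_polynomial {a b t : ℝ} (ha : 0 < a) (hb : 0 < b) (ht : 0 ≤ t)
    (p : Polynomial ℝ) : rlIntegral a (rlIntegral b fun s => p.eval s) t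
      = rlIntegral (a + b) (fun s => p.eval s) t := by
  rw [rlIntegral_congr ht fun s hs => rlIntegral_polynomial hb hs.1 p,
    rlIntegral_polynomial (add_pos ha hb) ht, rlIntegral_sum _ ha ht]
  swap
  · exact fun n _ => (continuous_const.mul (continuous_const.mul
      (Real.continuous_rpow_const (by positivity)))).continuousOn
  refine Finset.sum_congr rfl fun n _ => ?_
  have h1 := (Real.Gamma_pos_of_pos (show (0 : ℝ) < n + b + 1 by positivity)).ne'
  rw [rlIntegral_const_mul, rlIntegral_const_mul, rlIntegral_rpow ha (by positivity) ht,
    show (n : ℝ) + b + a = n + (a + b) by ring]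
  field_simp

/-- The semigroup law `J^a J^b = J^(a + b)` on continuous functions. -/
theorem rlIntegral_rlIntegral {a b t : ℝ} {f : ℝ → ℝ} (ha : 0 < a) (hb : 0 < b) (ht : 0 ≤ t)
    (hf : ContinuousOn f (Icc 0 t)) :
    rlIntegral a (rlIntegral b f) t = rlIntegral (a + b) f t := by
  have hGa := Real.Gamma_pos_of_pos (show 0 < a + 1 by positivity)
  have hGb := Real.Gamma_pos_of_pos (show 0 < b + 1 by positivity)
  have hGab := Real.Gamma_pos_of_pos (show 0 < a + b + 1 by positivity)
  set K := t ^ b / Real.Gamma (b + 1) / Real.Gamma (a + 1) * t ^ a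
    + t ^ (a + b) / Real.Gamma (a + b + 1) with hK
  have hK0 : 0 ≤ K := by positivity
  -- Both sides are continuous in `f` for the sup norm, and they agree on polynomials.
  refine eq_of_forall_dist_le fun ε hε => ?_
  rw [Real.dist_eq]
  obtain ⟨p, hp⟩ := exists_polynomial_near_of_continuousOn 0 t f hf (ε / (K + 1)) (by positivity)
  have hp' : ∀ s ∈ Icc 0 t, |f s - p.eval s| ≤ ε / (K + 1) := fun s hs =>
    (abs_sub_comm (f s) _).trans_le (hp s hs).le
  have hpc : ContinuousOn (fun s => p.eval s) (Icc 0 t) := by fun_prop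
  have h1 := abs_rlIntegral_sub_le (add_pos ha hb) ht hf hpc hp'
  have h2 : |rlIntegral a (rlIntegral b f) t - rlIntegral a (rlIntegral b fun s => p.eval s) t|
      ≤ (ε / (K + 1) / Real.Gamma (b + 1) * t ^ b) / Real.Gamma (a + 1) * t ^ a := by
    refine abs_rlIntegral_sub_le ha ht (continuousOn_rlIntegral_Icc hb hf)
      (continuousOn_rlIntegral_Icc hb hpc) fun s hs => ?_
    have hsub : Icc 0 s ⊆ Icc 0 t := Icc_subset_Icc_right hs.2
    refine (abs_rlIntegral_sub_le hb hs.1 (hf.mono hsub) (hpc.mono hsub)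
      fun x hx => hp' x (hsub hx)).trans ?_
    have := Real.rpow_le_rpow hs.1 hs.2 hb.le
    gcongr
  rw [rlIntegral_rlIntegral_polynomial ha hb ht] at h2
  have h3 := (abs_sub_le _ _ _).trans (add_le_add h2 ((abs_sub_comm _ _).trans_le h1))
  refine h3.trans ?_
  calc _ = ε * (K / (K + 1)) := by rw [hK]; ring
    _ ≤ ε * 1 := by
      gcongr
      rw [div_le_one (by positivity)]
      linarith
    _ = ε := mul_one ε

theorem rlIntegral_one (f : ℝ → ℝ) (t : ℝ) : rlIntegral 1 f t = ∫ s in (0 : ℝ)..t, f s := by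
  simp [rlIntegral]

theorem eq_of_rlIntegral_one_eq {f g : ℝ → ℝ} (hf : ContinuousOn f (Ici 0))
    (hg : ContinuousOn g (Ici 0)) (h : ∀ t, 0 ≤ t → rlIntegral 1 f t = rlIntegral 1 g t) {t : ℝ}
    (ht : 0 < t) : f t = g t := by
  have key : ∀ {f : ℝ → ℝ}, ContinuousOn f (Ici 0) → HasDerivAt (rlIntegral 1 f) (f t) t := by
    intro f hf
    rw [show rlIntegral 1 f = fun u => ∫ s in (0 : ℝ)..u, f s from funext (rlIntegral_one f)]
    have hn : Ici (0 : ℝ) ∈ nhds t := Ici_mem_nhds ht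
    refine intervalIntegral.integral_hasDerivAt_right ?_ ?_ (hf.continuousAt hn)
    · exact ContinuousOn.intervalIntegrable (hf.mono (by
        rw [uIcc_of_le ht.le]; exact Icc_subset_Ici_self))
    · exact ContinuousOn.stronglyMeasurableAtFilter_nhdsWithin hf measurableSet_Ici t
        |>.filter_mono (by rw [nhdsWithin_eq_nhds.2 hn])
  refine (key hf).unique ((key hg).congr_of_eventuallyEq ?_)
  filter_upwards [Ioi_mem_nhds ht] with u hu using h u (le_of_lt hu)

/-- A Caputo equation on `(0, ∞)` with continuous data is the Volterra equation
`f = f(0) + J^α g`. -/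
theorem eq_add_rlIntegral_of_hasCaputoDerivAt {α : ℝ} {f g : ℝ → ℝ} (hα : 0 < α) (hα1 : α ≤ 1)
    (hf : ContinuousOn f (Ici 0)) (hg : ContinuousOn g (Ici 0))
    (h : ∀ t, 0 < t → HasCaputoDerivAt α f (g t) t) {t : ℝ} (ht : 0 ≤ t) :
    f t = f 0 + rlIntegral α g t := by
  have hint : ∀ {F : ℝ → ℝ}, ContinuousOn F (Ici 0) → (∀ s, 0 < s → HasDerivAt F (g s) s) →
      ∀ t, 0 ≤ t → rlIntegral 1 g t = F t - F 0 := by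
    intro F hF hd t ht
    rw [rlIntegral_one]
    refine intervalIntegral.integral_eq_sub_of_hasDerivAt_of_le ht (hF.mono Icc_subset_Ici_self)
      (fun x hx => hd x hx.1) (ContinuousOn.intervalIntegrable (hg.mono ?_))
    rw [uIcc_of_le ht]
    exact Icc_subset_Ici_self
  unfold HasCaputoDerivAt at h
  rcases hα1.eq_or_lt with rfl | hα1
  · simp only [if_true] at h
    rw [hint hf h t ht]
    ring
  simp only [hα1.ne, if_false] at h
  rcases ht.eq_or_lt with rfl | ht
  · rw [rlIntegral_zero, add_zero]
  have hh : ContinuousOn (fun s => f s - f 0) (Ici 0) := hf.sub continuousOn_const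
  have h1 := hint (continuousOn_rlIntegral (sub_pos.2 hα1) hh) h
  -- Apply `J^α` to `J^(1-α) (f - f 0) = J^1 g`, use the semigroup law, and differentiate.
  have h2 : f t - f 0 = rlIntegral α g t := by
    refine eq_of_rlIntegral_one_eq hh (continuousOn_rlIntegral hα hg) (fun u hu => ?_) ht
    have hsub : Icc 0 u ⊆ Ici 0 := Icc_subset_Ici_self
    rw [rlIntegral_rlIntegral one_pos hα hu (hg.mono hsub), add_comm 1 α,
      ← rlIntegral_rlIntegral hα one_pos hu (hg.mono hsub)]
    conv_lhs => rw [show (1 : ℝ) = α + (1 - α) by ring]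
    rw [← rlIntegral_rlIntegral hα (sub_pos.2 hα1) hu (hh.mono hsub)]
    refine rlIntegral_congr hu fun s hs => ?_
    rw [h1 s hs.1, rlIntegral_zero, sub_zero]
  linarith

/-! ### Mittag-Leffler power series -/

/-- The fractional monomial `t^(αN) / Γ(αN + 1)`, which is the `N`-fold fractional integral `J^α`
of the constant `1`, and plays the role of `t^N / N!`. -/
noncomputable def mlTerm (α t : ℝ) (N : ℕ) : ℝ :=
  t ^ (α * N) / Real.Gamma (α * N + 1)

theorem mlTerm_zero (α t : ℝ) : mlTerm α t 0 = 1 := by simp [mlTerm]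

theorem mlTerm_nonneg {α t : ℝ} (hα : 0 < α) (ht : 0 ≤ t) (N : ℕ) : 0 ≤ mlTerm α t N :=
  div_nonneg (Real.rpow_nonneg ht _) (Real.Gamma_pos_of_pos (by positivity)).le

theorem continuous_mlTerm {α : ℝ} (hα : 0 < α) (N : ℕ) : Continuous fun t => mlTerm α t N :=
  (Real.continuous_rpow_const (by positivity)).div_const _

theorem rlIntegral_mlTerm {α t : ℝ} (hα : 0 < α) (ht : 0 ≤ t) (N : ℕ) :
    rlIntegral α (fun s => mlTerm α s N) t = mlTerm α t (N + 1) := by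
  have h0 := (Real.Gamma_pos_of_pos (show 0 < α * N + 1 by positivity)).ne'
  simp only [mlTerm, div_eq_inv_mul]
  rw [rlIntegral_const_mul, rlIntegral_rpow hα (by positivity) ht]
  push_cast
  rw [show α * (N + 1) = α * N + α by ring]
  field_simp

/-- Superexponential growth of `Γ`: cut the Gamma integral at `y`. -/
theorem rpow_mul_exp_neg_le_Gamma {y s : ℝ} (hy : 0 < y) (hs : 0 ≤ s) :
    y ^ s * Real.exp (-y) ≤ Real.Gamma (s + 1) := by
  have hi := Real.GammaIntegral_convergent (show 0 < s + 1 by positivity)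
  simp only [add_sub_cancel_right] at hi
  rw [Real.Gamma_eq_integral (by positivity), ← integral_exp_neg_Ioi, ← integral_const_mul]
  simp only [add_sub_cancel_right]
  have hsub : Ioi y ⊆ Ioi 0 := Ioi_subset_Ioi hy.le
  calc ∫ x in Ioi y, y ^ s * Real.exp (-x)
      ≤ ∫ x in Ioi y, Real.exp (-x) * x ^ s := by
        refine setIntegral_mono_on ((integrableOn_exp_neg_Ioi y).const_mul _)
          (hi.mono_set hsub) measurableSet_Ioi fun x hx => ?_
        rw [mul_comm]
        have := Real.rpow_le_rpow hy.le (le_of_lt hx) hs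
        gcongr
    _ ≤ ∫ x in Ioi 0, Real.exp (-x) * x ^ s := by
        refine setIntegral_mono_set hi ?_ hsub.eventuallyLE
        refine (ae_restrict_iff' measurableSet_Ioi).2 (ae_of_all _ fun x hx => ?_)
        have := Real.rpow_nonneg (le_of_lt hx) s
        positivity

theorem summable_pow_mul_mlTerm {α t x : ℝ} (hα : 0 < α) (ht : 0 ≤ t) (hx : 0 ≤ x) :
    Summable fun N => x ^ N * mlTerm α t N := by
  set z := x * t ^ α with hz
  have hz0 : 0 ≤ z := by positivity
  -- For this `y` the Gamma bound makes the series a geometric one with ratio `z / (2 z + 1)`.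
  set y := (2 * z + 1) ^ α⁻¹ with hy
  have hy0 : 0 < y := by positivity
  have hyα : y ^ α = 2 * z + 1 := by
    rw [hy, ← Real.rpow_mul (by positivity), inv_mul_cancel₀ hα.ne', Real.rpow_one]
  have hq : z / (2 * z + 1) < 1 := by
    rw [div_lt_one (by positivity)]
    linarith
  refine Summable.of_nonneg_of_le (fun N => mul_nonneg (by positivity) (mlTerm_nonneg hα ht N))
    (fun N => ?_) ((summable_geometric_of_lt_one (by positivity) hq).mul_left (Real.exp y))
  have hG := rpow_mul_exp_neg_le_Gamma hy0 (show 0 ≤ α * N by positivity)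
  have hp : 0 < y ^ (α * N) * Real.exp (-y) := by positivity
  calc x ^ N * mlTerm α t N = z ^ N / Real.Gamma (α * N + 1) := by
        rw [mlTerm, Real.rpow_mul ht, Real.rpow_natCast, hz, mul_pow, mul_div_assoc]
    _ ≤ z ^ N / (y ^ (α * N) * Real.exp (-y)) := by gcongr
    _ = Real.exp y * (z / (2 * z + 1)) ^ N := by
        rw [Real.rpow_mul hy0.le, hyα, Real.rpow_natCast, Real.exp_neg, div_pow]
        field_simp

/-! ### The Volterra equation of the queue -/

/-- The right-hand side of the difference-differential equations of the M/M/1 queue, as a linear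
operator on sequences indexed by the number of customers. -/
def generator (lam mu : ℝ) : Module.End ℝ (ℕ → ℝ) where
  toFun v k := match k with
    | 0 => -lam * v 0 + mu * v 1
    | j + 1 => -(lam + mu) * v (j + 1) + lam * v j + mu * v (j + 2)
  map_add' v w := by
    funext k
    cases k <;> simp only [Pi.add_apply] <;> ring
  map_smul' a v := by
    funext k
    cases k <;> simp only [Pi.smul_apply, smul_eq_mul, RingHom.id_apply] <;> ring

theorem generator_apply_zero (lam mu : ℝ) (v : ℕ → ℝ) :
    generator lam mu v 0 = -lam * v 0 + mu * v 1 := rfl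

theorem generator_apply_succ (lam mu : ℝ) (v : ℕ → ℝ) (k : ℕ) :
    generator lam mu v (k + 1) = -(lam + mu) * v (k + 1) + lam * v k + mu * v (k + 2) := rfl

theorem abs_generator_le {lam mu B : ℝ} (hlam : 0 < lam) (hmu : 0 < mu) {v : ℕ → ℝ}
    (h : ∀ k, |v k| ≤ B) (k : ℕ) : |generator lam mu v k| ≤ 2 * (lam + mu) * B := by
  have hB : 0 ≤ B := (abs_nonneg _).trans (h 0)
  have h' := fun k => abs_le.1 (h k)
  rcases k with _ | k
  · rw [generator_apply_zero, abs_le]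
    constructor <;> nlinarith [h' 0, h' 1, mul_nonneg hlam.le hB, mul_nonneg hmu.le hB]
  · rw [generator_apply_succ, abs_le]
    constructor <;>
      nlinarith [h' k, h' (k + 1), h' (k + 2), mul_nonneg hlam.le hB, mul_nonneg hmu.le hB]

theorem continuousOn_generator {lam mu : ℝ} {p : ℕ → ℝ → ℝ} {s : Set ℝ}
    (h : ∀ k, ContinuousOn (p k) s) (k : ℕ) :
    ContinuousOn (fun t => generator lam mu (fun j => p j t) k) s := by
  rcases k with _ | k
  · exact (continuousOn_const.mul (h 0)).add (continuousOn_const.mul (h 1))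
  · exact ((continuousOn_const.mul (h (k + 1))).add (continuousOn_const.mul (h k))).add
      (continuousOn_const.mul (h (k + 2)))

/-- Picard iteration for the Volterra equation, with the error after `M` steps. -/
theorem abs_sub_sum_generator_pow_le {α lam mu : ℝ} (hα : 0 < α) (hlam : 0 < lam) (hmu : 0 < mu)
    {v : ℕ → ℝ} {p : ℕ → ℝ → ℝ} (hc : ∀ k, ContinuousOn (p k) (Ici 0))
    (hb : ∀ k t, 0 ≤ t → |p k t| ≤ 1)
    (hp : ∀ k t, 0 ≤ t →
      p k t = v k + rlIntegral α (fun s => generator lam mu (fun j => p j s) k) t)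
    (M k : ℕ) {t : ℝ} (ht : 0 ≤ t) :
    |p k t - ∑ N ∈ Finset.range M, (generator lam mu ^ N) v k * mlTerm α t N|
      ≤ (2 * (lam + mu)) ^ M * mlTerm α t M := by
  induction M generalizing k t with
  | zero => simpa [mlTerm_zero] using hb k t ht
  | succ M ih =>
    have hcont : ∀ N, Continuous fun s => (generator lam mu ^ (N + 1)) v k * mlTerm α s N :=
      fun N => continuous_const.mul (continuous_mlTerm hα N)
    have hsub : Icc 0 t ⊆ Ici 0 := Icc_subset_Ici_self
    have hgen : ∀ s, generator lam mu (fun j => p j s - ∑ N ∈ Finset.range M,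
          (generator lam mu ^ N) v j * mlTerm α s N) k
        = generator lam mu (fun j => p j s) k
          - ∑ N ∈ Finset.range M, (generator lam mu ^ (N + 1)) v k * mlTerm α s N := by
      intro s
      have : (fun j => p j s - ∑ N ∈ Finset.range M, (generator lam mu ^ N) v j * mlTerm α s N)
          = (fun j => p j s) - ∑ N ∈ Finset.range M, mlTerm α s N • (generator lam mu ^ N) v := by
        funext j
        simp [mul_comm]
      rw [this, map_sub, map_sum]
      simp [pow_succ', mul_comm]
    have hrec : p k t - ∑ N ∈ Finset.range (M + 1), (generator lam mu ^ N) v k * mlTerm α t N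
        = rlIntegral α (fun s => generator lam mu (fun j => p j s - ∑ N ∈ Finset.range M,
          (generator lam mu ^ N) v j * mlTerm α s N) k) t := by
      simp_rw [hgen]
      rw [rlIntegral_sub hα ht ((continuousOn_generator hc k).mono hsub)
        (continuous_finsetSum _ fun N _ => hcont N).continuousOn,
        rlIntegral_sum _ hα ht fun N _ => (hcont N).continuousOn,
        Finset.sum_range_succ', hp k t ht]
      simp only [rlIntegral_const_mul, rlIntegral_mlTerm hα ht, mlTerm_zero, pow_zero,
        Module.End.one_apply]
      ring
    rw [hrec, pow_succ', mul_assoc, ← rlIntegral_mlTerm hα ht, ← rlIntegral_const_mul,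
      ← rlIntegral_const_mul]
    refine abs_rlIntegral_le hα ht ?_ fun s hs => ?_
    · exact (continuous_const.mul (continuous_const.mul (continuous_mlTerm hα M))).continuousOn
    · exact abs_generator_le hlam hmu (fun j => ih j hs.1) k

theorem tendsto_sum_generator_pow {α lam mu : ℝ} (hα : 0 < α) (hlam : 0 < lam) (hmu : 0 < mu)
    {v : ℕ → ℝ} {p : ℕ → ℝ → ℝ} (hc : ∀ k, ContinuousOn (p k) (Ici 0))
    (hb : ∀ k t, 0 ≤ t → |p k t| ≤ 1)
    (hp : ∀ k t, 0 ≤ t →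
      p k t = v k + rlIntegral α (fun s => generator lam mu (fun j => p j s) k) t)
    (k : ℕ) {t : ℝ} (ht : 0 ≤ t) :
    Filter.Tendsto (fun M => ∑ N ∈ Finset.range M, (generator lam mu ^ N) v k * mlTerm α t N)
      Filter.atTop (nhds (p k t)) := by
  have h0 := (summable_pow_mul_mlTerm hα ht (x := 2 * (lam + mu))
    (by positivity)).tendsto_atTop_zero
  rw [tendsto_iff_dist_tendsto_zero]
  refine squeeze_zero (fun _ => dist_nonneg) (fun M => ?_) h0
  rw [dist_comm, Real.dist_eq]
  exact abs_sub_sum_generator_pow_le hα hlam hmu hc hb hp M k ht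

theorem tendsto_stateProb {Ω : Type*} [MeasurableSpace Ω] {P : Measure Ω} [IsProbabilityMeasure P]
    {N : ℝ≥0 → Ω → ℕ} {α lam mu : ℝ} {i : ℕ} (hα : 0 < α) (hα1 : α ≤ 1) (hlam : 0 < lam)
    (hmu : 0 < mu) (hN : IsFractionalMM1Queue α lam mu i P N) (k : ℕ) {t : ℝ} (ht : 0 ≤ t) :
    Filter.Tendsto (fun M => ∑ n ∈ Finset.range M,
        (generator lam mu ^ n) (fun j => if j = i then 1 else 0) k * mlTerm α t n)
      Filter.atTop (nhds (stateProb P N i k t)) := by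
  have : IsProbabilityMeasure (ProbabilityTheory.cond P {ω | N 0 ω = i}) :=
    cond_isProbabilityMeasure hN.start
  refine tendsto_sum_generator_pow hα hlam hmu hN.continuousOn (fun k t _ => ?_)
    (fun k t ht => ?_) k ht
  · rw [stateProb, abs_of_nonneg measureReal_nonneg]
    exact measureReal_le_one
  · rw [← hN.init k]
    refine eq_add_rlIntegral_of_hasCaputoDerivAt hα hα1 (hN.continuousOn k)
      (continuousOn_generator hN.continuousOn k) (fun s hs => ?_) ht
    rcases k with _ | k
    · exact hN.eq_zero s hs
    · exact hN.eq_succ (k + 1) (Nat.le_add_left 1 k) s hs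

/-! ### The uniformized walk -/

/-- The weighted step operator of the uniformized walk, which has a loop of weight `mu` at `0`: the
generator of the queue plus `lam + mu` times the identity. -/
def jump (lam mu : ℝ) : Module.End ℝ (ℕ → ℝ) :=
  generator lam mu + (lam + mu) • 1

theorem jump_apply_zero (lam mu : ℝ) (v : ℕ → ℝ) :
    jump lam mu v 0 = mu * v 0 + mu * v 1 := by
  simp [jump, generator_apply_zero]
  ring

theorem jump_apply_succ (lam mu : ℝ) (v : ℕ → ℝ) (k : ℕ) :
    jump lam mu v (k + 1) = lam * v k + mu * v (k + 2) := by
  simp [jump, generator_apply_succ]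
  ring

theorem generator_pow_apply (lam mu : ℝ) (N : ℕ) (v : ℕ → ℝ) (k : ℕ) :
    (generator lam mu ^ N) v k = ∑ n ∈ Finset.range (N + 1),
      (N.choose n : ℝ) * (-(lam + mu)) ^ (N - n) * (jump lam mu ^ n) v k := by
  have h : generator lam mu = jump lam mu + (-(lam + mu)) • 1 := by
    rw [jump, add_assoc, ← add_smul, add_neg_cancel, zero_smul, add_zero]
  rw [h, ((Commute.one_right _).smul_right _).add_pow, LinearMap.sum_apply, Finset.sum_apply]
  refine Finset.sum_congr rfl fun n _ => ?_
  rw [smul_pow, one_pow, ← nsmul_eq_mul']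
  simp
  ring

/-- The ballot number `(r - m) / (r + m) * (r + m).choose r` with `r + m = n + 1`, written as a
difference of binomial coefficients. -/
def ballot (n : ℕ) : ℕ → ℝ
  | 0 => -1
  | r + 1 => n.choose r - n.choose (r + 1)

theorem ballot_succ_succ (n r : ℕ) :
    ballot (n + 1) (r + 1) = ballot n r + ballot n (r + 1) := by
  rcases r with _ | r
  · simp only [ballot, zero_add, Nat.choose_zero_right, Nat.choose_one_right]
    push_cast
    ring
  · simp only [ballot, Nat.choose_succ_succ' n]
    push_cast
    ring

theorem ballot_add_two (n : ℕ) : ballot n (n + 2) = 0 := by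
  simp [ballot, Nat.choose_eq_zero_of_lt (show n < n + 1 + 1 by omega)]

theorem div_mul_choose_eq_ballot {n r m : ℕ} (h : r + m = n + 1) :
    ((r : ℝ) - m) / ((r : ℝ) + m) * ((r + m).choose r : ℝ) = ballot n r := by
  have hn : (r : ℝ) + m = n + 1 := by exact_mod_cast h
  have hn0 : (n : ℝ) + 1 ≠ 0 := by positivity
  rw [h, hn]
  rcases r with _ | r
  · have : (m : ℝ) = n + 1 := by simpa using hn
    rw [this]
    simp only [ballot, Nat.choose_zero_right]
    field_simp
    simp
  · have h1 : ((n : ℝ) + 1) * n.choose r = (n + 1).choose (r + 1) * (r + 1) := by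
      exact_mod_cast Nat.add_one_mul_choose_eq n r
    have h2 : ((n + 1).choose (r + 1) : ℝ) = n.choose r + n.choose (r + 1) := by
      exact_mod_cast Nat.choose_succ_succ' n r
    have h3 : (m : ℝ) = n + 1 - (r + 1) := by
      push_cast at hn
      linarith
    rw [h3, ballot, show (n.choose (r + 1) : ℝ) = (n + 1).choose (r + 1) - n.choose r by linarith]
    field_simp
    push_cast
    linarith

/-- The total weight of the `n`-step walks from `i` to `k` that visit `0`, divided by
`(lam / mu) ^ k`. It depends on `i` and `k` only through `s = k + i`; the value at `s = -1` enters
the recurrence `boundaryPart_succ`, hence `s : ℤ`. For `r = n + 1` the exponent of `mu` is `-1`. -/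
noncomputable def boundaryPart (lam mu : ℝ) (n : ℕ) (s : ℤ) : ℝ :=
  (1 - lam / mu) * (lam + mu) ^ n + ∑ r ∈ Finset.range (n + 2),
    if (n : ℤ) + 1 ≤ 2 * r + s then ballot n r * lam ^ r * mu ^ ((n : ℤ) - r) else 0

/-- Pascal's rule, summed over the truncated ballot numbers. -/
theorem boundaryPart_succ {lam mu : ℝ} (hmu : mu ≠ 0) (n : ℕ) (s : ℤ) :
    boundaryPart lam mu (n + 1) s
      = mu * boundaryPart lam mu n (s - 1) + lam * boundaryPart lam mu n (s + 1) := by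
  have h1 : ∀ r : ℕ, mu * (if (n : ℤ) + 1 ≤ 2 * r + (s - 1) then
      ballot n r * lam ^ r * mu ^ ((n : ℤ) - r) else 0)
      = if (n : ℤ) + 2 ≤ 2 * r + s then ballot n r * lam ^ r * mu ^ ((n : ℤ) + 1 - r) else 0 := by
    intro r
    rw [mul_ite, mul_zero]
    refine if_congr (by constructor <;> intro h <;> linarith) ?_ rfl
    rw [show (n : ℤ) + 1 - r = (n - r) + 1 by ring, zpow_add_one₀ hmu]
    ring
  have h2 : ∀ r : ℕ, lam * (if (n : ℤ) + 1 ≤ 2 * r + (s + 1) then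
      ballot n r * lam ^ r * mu ^ ((n : ℤ) - r) else 0)
      = if (n : ℤ) ≤ 2 * r + s then ballot n r * lam ^ (r + 1) * mu ^ ((n : ℤ) - r) else 0 := by
    intro r
    rw [mul_ite, mul_zero]
    refine if_congr (by constructor <;> intro h <;> linarith) ?_ rfl
    ring
  have h3 : ∑ r ∈ Finset.range (n + 2),
      (if (n : ℤ) + 2 ≤ 2 * r + s then ballot n r * lam ^ r * mu ^ ((n : ℤ) + 1 - r) else 0)
      = ∑ r ∈ Finset.range (n + 3),
      (if (n : ℤ) + 2 ≤ 2 * r + s then ballot n r * lam ^ r * mu ^ ((n : ℤ) + 1 - r) else 0) := by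
    rw [Finset.sum_range_succ _ (n + 2), ballot_add_two]
    simp
  simp only [boundaryPart, mul_add, Finset.mul_sum, h1, h2, h3]
  rw [Finset.sum_range_succ' _ (n + 2), Finset.sum_range_succ' _ (n + 2)]
  have h4 : ∀ r : ℕ, (if ((n + 1 : ℕ) : ℤ) + 1 ≤ 2 * (r + 1 : ℕ) + s then
      ballot (n + 1) (r + 1) * lam ^ (r + 1) * mu ^ (((n + 1 : ℕ) : ℤ) - (r + 1 : ℕ)) else 0)
      = (if (n : ℤ) + 2 ≤ 2 * (r + 1 : ℕ) + s then
          ballot n (r + 1) * lam ^ (r + 1) * mu ^ ((n : ℤ) + 1 - (r + 1 : ℕ)) else 0)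
        + if (n : ℤ) ≤ 2 * r + s then ballot n r * lam ^ (r + 1) * mu ^ ((n : ℤ) - r) else 0 := by
    intro r
    rw [ballot_succ_succ]
    push_cast
    rw [show (n : ℤ) + 1 - (r + 1) = n - r by ring]
    by_cases h : (n : ℤ) ≤ 2 * r + s
    · rw [if_pos (by linarith), if_pos (by linarith), if_pos h]
      ring
    · rw [if_neg (by linarith), if_neg (by linarith), if_neg h, add_zero]
  simp only [h4, Finset.sum_add_distrib]
  have h5 : (if ((n + 1 : ℕ) : ℤ) + 1 ≤ 2 * (0 : ℕ) + s then
      ballot (n + 1) 0 * lam ^ 0 * mu ^ (((n + 1 : ℕ) : ℤ) - (0 : ℕ)) else 0)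
      = if (n : ℤ) + 2 ≤ 2 * (0 : ℕ) + s then
          ballot n 0 * lam ^ 0 * mu ^ ((n : ℤ) + 1 - (0 : ℕ)) else 0 := by
    push_cast
    exact if_congr (by constructor <;> intro h <;> linarith) rfl rfl
  rw [h5, pow_succ]
  ring

/-- Lowering `s` by one removes at most one ballot term. -/
theorem boundaryPart_sub_boundaryPart (lam mu : ℝ) (n : ℕ) (s : ℤ) :
    boundaryPart lam mu n s - boundaryPart lam mu n (s - 1) = ∑ r ∈ Finset.range (n + 2),
      if (n : ℤ) + 1 = 2 * r + s then ballot n r * lam ^ r * mu ^ ((n : ℤ) - r) else 0 := by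
  rw [boundaryPart, boundaryPart, add_sub_add_left_eq_sub, ← Finset.sum_sub_distrib]
  refine Finset.sum_congr rfl fun r _ => ?_
  rcases lt_trichotomy ((n : ℤ) + 1) (2 * r + s) with h | h | h
  · rw [if_pos h.le, if_pos (by linarith), if_neg h.ne, sub_self]
  · rw [if_pos h.le, if_neg (by linarith), if_pos h, sub_zero]
  · rw [if_neg (by linarith), if_neg (by linarith), if_neg h.ne', sub_self]

/-- The total weight of the `n`-step walks from `i` to `k` that avoid `0`, counted by reflection.
Such a walk has `r` downward and `n - r` upward steps with `k + 2 r = n + i`; the value is `0` when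
there is no such `r`. -/
noncomputable def walkPart (lam mu : ℝ) (i n k : ℕ) : ℝ :=
  if k + 2 * ((n + i - k) / 2) = n + i then
    ((n.choose ((n + i - k) / 2) : ℝ) - (n.choose (k + (n + i - k) / 2) : ℝ))
      * lam ^ ((n : ℤ) - ((n + i - k) / 2 : ℕ)) * mu ^ ((n + i - k) / 2)
  else 0

theorem walkPart_of_eq (lam mu : ℝ) {i n k r : ℕ} (h : k + 2 * r = n + i) :
    walkPart lam mu i n k
      = ((n.choose r : ℝ) - (n.choose (k + r) : ℝ)) * lam ^ ((n : ℤ) - r) * mu ^ r := by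
  have hr : (n + i - k) / 2 = r := by omega
  rw [walkPart, hr, if_pos h]

theorem walkPart_of_ne (lam mu : ℝ) {i n k : ℕ} (h : ∀ r, k + 2 * r ≠ n + i) :
    walkPart lam mu i n k = 0 := if_neg (h _)

theorem walkPart_zero_right (lam mu : ℝ) (i n : ℕ) : walkPart lam mu i n 0 = 0 := by
  by_cases h : ∃ r, 0 + 2 * r = n + i
  · obtain ⟨r, h⟩ := h
    rw [walkPart_of_eq lam mu h, zero_add, sub_self, zero_mul, zero_mul]
  · exact walkPart_of_ne lam mu (not_exists.1 h)

theorem walkPart_succ_succ {lam : ℝ} (hlam : lam ≠ 0) (mu : ℝ) (i n k : ℕ) :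
    walkPart lam mu i (n + 1) (k + 1)
      = lam * walkPart lam mu i n k + mu * walkPart lam mu i n (k + 2) := by
  by_cases h : ∃ r, k + 2 * r = n + i
  · obtain ⟨r, h⟩ := h
    rw [walkPart_of_eq lam mu h,
      walkPart_of_eq lam mu (show (k + 1) + 2 * r = (n + 1) + i by omega)]
    have hz : lam ^ (((n + 1 : ℕ) : ℤ) - r) = lam * lam ^ ((n : ℤ) - r) := by
      rw [← zpow_one_add₀ hlam]
      push_cast
      ring_nf
    rcases r with _ | r
    · have h0 : (n + 1).choose (k + 1 + 0) = n.choose (k + 0) := by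
        rw [add_zero, add_zero, Nat.choose_succ_succ', Nat.choose_eq_zero_of_lt (k := k + 1)
          (by omega), add_zero]
      rw [walkPart_of_ne lam mu (fun r => by omega), hz, h0, Nat.choose_zero_right,
        Nat.choose_zero_right]
      ring
    · have hz' : lam ^ ((n : ℤ) - r) = lam * lam ^ ((n : ℤ) - (r + 1 : ℕ)) := by
        rw [← zpow_one_add₀ hlam]
        push_cast
        ring_nf
      rw [walkPart_of_eq lam mu (show (k + 2) + 2 * r = n + i by omega), hz, hz',
        show k + 1 + (r + 1) = (k + (r + 1)) + 1 by ring, show k + 2 + r = k + (r + 1) + 1 by ring,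
        Nat.choose_succ_succ' n r, Nat.choose_succ_succ' n (k + (r + 1))]
      push_cast
      ring
  · rw [not_exists] at h
    rw [walkPart_of_ne lam mu h, walkPart_of_ne lam mu fun r hr => h r (by omega),
      walkPart_of_ne lam mu fun r hr => h (r + 1) (by omega)]
    ring

/-- At the boundary the ballot term and the reflected walk term cancel, by the symmetry
`n.choose r = n.choose (n - r)`. -/
theorem boundaryPart_sub_add_walkPart_one (lam mu : ℝ) (i n : ℕ) :
    boundaryPart lam mu n i - boundaryPart lam mu n (i - 1) + walkPart lam mu i n 1 = 0 := by
  rw [boundaryPart_sub_boundaryPart]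
  by_cases h : ∃ r, n + 1 = 2 * r + i
  · obtain ⟨r, h⟩ := h
    have hr : r ≤ n := by omega
    rw [Finset.sum_eq_single_of_mem r (Finset.mem_range.2 (by omega)) fun j _ hj =>
        if_neg (by omega), if_pos (by exact_mod_cast h),
      walkPart_of_eq lam mu (show 1 + 2 * (n - r) = n + i by omega), Nat.choose_symm hr]
    have hb : ballot n r = (n.choose (1 + (n - r)) : ℝ) - n.choose r := by
      rcases r with _ | r
      · simp [ballot, Nat.choose_eq_zero_of_lt (show n < 1 + n by omega)]
      · rw [show 1 + (n - (r + 1)) = n - r by omega, Nat.choose_symm (by omega), ballot]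
    rw [hb, Nat.cast_sub hr, sub_sub_cancel, ← Nat.cast_sub hr, zpow_natCast, zpow_natCast]
    ring
  · rw [not_exists] at h
    rw [Finset.sum_eq_zero fun j _ => if_neg fun hj => h j (by exact_mod_cast hj), zero_add]
    by_cases h' : ∃ r, 1 + 2 * r = n + i
    · obtain ⟨r, h'⟩ := h'
      -- The parity matches, so the ballot term is missing only because `i > n + 1`.
      have hr : n < r := by
        by_contra! hr
        exact h (n - r) (by omega)
      rw [walkPart_of_eq lam mu h', Nat.choose_eq_zero_of_lt hr,
        Nat.choose_eq_zero_of_lt (show n < 1 + r by omega)]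
      simp
    · exact walkPart_of_ne lam mu (not_exists.1 h')

/-- The weights of the walk, split according to whether it visits `0`. -/
theorem jump_pow_apply {lam mu : ℝ} (hlam : lam ≠ 0) (hmu : mu ≠ 0) (i n k : ℕ) :
    (jump lam mu ^ n) (fun j => if j = i then 1 else 0) k
      = (lam / mu) ^ k * boundaryPart lam mu n ((k : ℤ) + i) + walkPart lam mu i n k := by
  induction n generalizing k with
  | zero =>
    have hb : boundaryPart lam mu 0 ((k : ℤ) + i) = if k + i = 0 then 1 else 0 := by
      simp only [boundaryPart, zero_add, Finset.sum_range_succ, Finset.sum_range_zero, ballot]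
      rcases Nat.eq_zero_or_pos (k + i) with h | h
      · have h' : (k : ℤ) + i = 0 := by exact_mod_cast h
        rw [h', if_pos h]
        simp [div_eq_mul_inv]
      · have h' : (1 : ℤ) ≤ (k : ℤ) + i := by exact_mod_cast h
        rw [if_neg h.ne', if_pos (by simpa using h'), if_pos (by push_cast; linarith)]
        simp [div_eq_mul_inv]
    rw [hb, pow_zero, Module.End.one_apply]
    by_cases h : ∃ r, k + 2 * r = 0 + i
    · obtain ⟨r, h⟩ := h
      rw [walkPart_of_eq lam mu h]
      rcases r with _ | r
      · rcases k with _ | k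
        · obtain rfl : i = 0 := by omega
          simp
        · rw [if_pos (by omega), if_neg (by omega)]
          simp
      · rw [if_neg (by omega), if_neg (by omega), Nat.choose_eq_zero_of_lt (by omega),
          Nat.choose_eq_zero_of_lt (by omega)]
        simp
    · rw [not_exists] at h
      have h0 := h 0
      rw [walkPart_of_ne lam mu h, if_neg (by omega), if_neg (by omega)]
      simp
  | succ n ih =>
    rw [pow_succ', Module.End.mul_apply]
    rcases k with _ | k
    · rw [jump_apply_zero, ih, ih, walkPart_zero_right, walkPart_zero_right, boundaryPart_succ hmu]
      have h := boundaryPart_sub_add_walkPart_one lam mu i n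
      simp only [Nat.cast_zero, zero_add, pow_zero, one_mul, pow_one, Nat.cast_one, add_zero]
      have h1 : mu * (lam / mu) = lam := mul_div_cancel₀ _ hmu
      rw [add_comm (i : ℤ) 1]
      linear_combination mu * h + boundaryPart lam mu n (1 + i) * h1
    · rw [jump_apply_succ, ih, ih, boundaryPart_succ hmu, walkPart_succ_succ hlam]
      have h1 : mu * (lam / mu) = lam := mul_div_cancel₀ _ hmu
      push_cast
      rw [show (k : ℤ) + 1 + i - 1 = k + i by ring, show (k : ℤ) + 1 + i + 1 = k + 2 + i by ring,
        pow_succ, pow_succ]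
      linear_combination -(lam / mu) ^ k * boundaryPart lam mu n (k + i) * h1
        + (lam / mu) ^ k * (lam / mu) * boundaryPart lam mu n (k + 2 + i) * h1

/-! ### Prabhakar functions as binomial transforms -/

/-- The binomial transform `∑ N, N.choose n * (-c) ^ (N - n) * mlTerm α t N`. It is the Prabhakar
factor common to all terms of the two series whose index is `n`; for `α = 1` it equals
`t ^ n / n! * exp (-c t)`. -/
noncomputable def poissonML (α c t : ℝ) (n : ℕ) : ℝ :=
  ∑' N : ℕ, (N.choose n : ℝ) * (-c) ^ (N - n) * mlTerm α t N

theorem rpow_mul_prabhakar {α t : ℝ} (hα : 0 < α) (ht : 0 ≤ t) (c : ℝ) (n : ℕ) :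
    t ^ (α * n) * prabhakar α (α * n + 1) (n + 1) (-c * t ^ α) = poissonML α c t n := by
  have hinj : Function.Injective fun r : ℕ => n + r := add_right_injective n
  rw [poissonML, ← hinj.tsum_eq]
  · rw [prabhakar, ← tsum_mul_left]
    refine tsum_congr fun r => ?_
    have h1 : (ascPochhammer ℝ r).eval ((n : ℝ) + 1) = r.factorial * (n + r).choose n := by
      have h := ascPochhammer_eval_cast (S := ℝ) r (n + 1)
      rw [ascPochhammer_nat_eq_ascFactorial, Nat.ascFactorial_eq_factorial_mul_choose,
        ← Nat.choose_symm_add] at h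
      push_cast at h
      exact h.symm
    have h2 : (r.factorial : ℝ) ≠ 0 := by positivity
    have h3 : (Real.Gamma (α * r + (α * n + 1))) ≠ 0 :=
      (Real.Gamma_pos_of_pos (by positivity)).ne'
    have h4 : t ^ (α * ((n + r : ℕ) : ℝ)) = t ^ (α * n) * (t ^ α) ^ r := by
      rw [Real.rpow_mul ht, Real.rpow_natCast, pow_add, Real.rpow_mul ht, Real.rpow_natCast]
    rw [h1, mlTerm, h4, Nat.add_sub_cancel_left, mul_pow,
      show α * ((n + r : ℕ) : ℝ) + 1 = α * r + (α * n + 1) by push_cast; ring]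
    field_simp
  · intro N hN
    by_contra hr
    refine hN ?_
    have : N < n := by
      by_contra! hn
      exact hr ⟨N - n, Nat.add_sub_cancel' hn⟩
    simp [Nat.choose_eq_zero_of_lt this]

/-- Fubini for `∑ n, w n * poissonML α c t n`, when `w` grows at most geometrically. -/
theorem exists_hasSum_mul_poissonML {α c t K x : ℝ} (hα : 0 < α) (ht : 0 ≤ t) (hc : 0 ≤ c)
    (hx : 0 ≤ x) {w : ℕ → ℝ} (hw : ∀ n, |w n| ≤ K * x ^ n) :
    ∃ S, HasSum (fun n => w n * poissonML α c t n) S ∧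
      HasSum (fun N => (∑ n ∈ Finset.range (N + 1),
        (N.choose n : ℝ) * (-c) ^ (N - n) * w n) * mlTerm α t N) S := by
  set f : ℕ × ℕ → ℝ := fun p => (p.1.choose p.2 : ℝ) * (-c) ^ (p.1 - p.2) * w p.2 * mlTerm α t p.1
    with hf
  have hz : ∀ N n, n ∉ Finset.range (N + 1) → f (N, n) = 0 := fun N n h => by
    simp [hf, Nat.choose_eq_zero_of_lt (show N < n by simpa using h)]
  have hsum : Summable f := by
    rw [← summable_norm_iff, summable_prod_of_nonneg fun p => norm_nonneg _]
    refine ⟨fun N => summable_of_ne_finset_zero (s := Finset.range (N + 1)) fun n h => by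
      rw [hz N n h, norm_zero], ?_⟩
    refine Summable.of_nonneg_of_le (fun N => tsum_nonneg fun n => norm_nonneg _) (fun N => ?_)
      ((summable_pow_mul_mlTerm hα ht (x := x + c) (by positivity)).mul_left K)
    rw [tsum_eq_sum (s := Finset.range (N + 1)) fun n h => by rw [hz N n h, norm_zero], add_pow,
      Finset.sum_mul, Finset.mul_sum]
    refine Finset.sum_le_sum fun n _ => ?_
    have hm := mlTerm_nonneg hα ht N
    rw [hf]
    simp only [norm_mul, norm_pow, Real.norm_eq_abs, abs_neg, abs_of_nonneg hc, Nat.abs_cast,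
      abs_of_nonneg hm]
    calc _ ≤ (N.choose n : ℝ) * c ^ (N - n) * (K * x ^ n) * mlTerm α t N := by
          have := hw n
          gcongr
      _ = _ := by ring
  refine ⟨∑' p, f p, ?_, ?_⟩
  · have h := (hsum.prod_symm.hasSum.prod_fiberwise fun n => (hsum.prod_symm.prod_factor n).hasSum)
    rw [show ∑' p : ℕ × ℕ, f p.swap = ∑' p, f p from (Equiv.prodComm ℕ ℕ).tsum_eq f] at h
    refine h.congr_fun fun n => ?_
    rw [poissonML, ← tsum_mul_left]
    refine tsum_congr fun N => ?_
    simp only [hf, Prod.swap]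
    ring
  · have h := hsum.hasSum.prod_fiberwise fun N => (hsum.prod_factor N).hasSum
    refine h.congr_fun fun N => ?_
    rw [tsum_eq_sum (hz N), Finset.sum_mul]

theorem hasSum_pow_mul_poissonML {α c t : ℝ} (hα : 0 < α) (ht : 0 ≤ t) (hc : 0 ≤ c) :
    HasSum (fun n => c ^ n * poissonML α c t n) 1 := by
  obtain ⟨S, h1, h2⟩ := exists_hasSum_mul_poissonML (K := 1) hα ht hc hc
    (w := fun n => c ^ n) fun n => by rw [abs_of_nonneg (by positivity), one_mul]
  have h3 : HasSum (fun N => (∑ n ∈ Finset.range (N + 1),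
      (N.choose n : ℝ) * (-c) ^ (N - n) * c ^ n) * mlTerm α t N) 1 := by
    have h0 : ∀ N, ∑ n ∈ Finset.range (N + 1), (N.choose n : ℝ) * (-c) ^ (N - n) * c ^ n
        = 0 ^ N := fun N => by
      rw [← add_neg_cancel c, add_pow]
      exact Finset.sum_congr rfl fun n _ => by ring
    simp only [h0]
    convert hasSum_single 0 fun N hN => ?_ using 1
    · simp [mlTerm_zero]
    · simp [hN]
  rwa [h2.unique h3] at h1

theorem summable_pow_mul_abs_poissonML {α c t x : ℝ} (hα : 0 < α) (ht : 0 ≤ t) (hc : 0 ≤ c)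
    (hx : 0 ≤ x) : Summable fun n => x ^ n * |poissonML α c t n| := by
  obtain ⟨S, h, -⟩ := exists_hasSum_mul_poissonML (K := 1) hα ht hc hx
    (w := fun n => x ^ n) fun n => by rw [abs_of_nonneg (by positivity), one_mul]
  refine h.summable.abs.congr fun n => ?_
  rw [abs_mul, abs_of_nonneg (by positivity)]

/-! ### The two series -/

/-- A double series truncated in each row can be summed along antidiagonals. -/
theorem hasSum_sum_range_of_summable_antidiagonal {f : ℕ × ℕ → ℝ} (L : ℕ → ℕ)
    (hf : Summable fun n => ∑ p ∈ Finset.HasAntidiagonal.antidiagonal n, |f p|) :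
    ∃ S, HasSum (fun r => ∑ m ∈ Finset.range (L r), f (r, m)) S ∧
      HasSum (fun n => ∑ p ∈ Finset.HasAntidiagonal.antidiagonal n,
        if p.2 < L p.1 then f p else 0) S := by
  set g : ℕ × ℕ → ℝ := fun p => if p.2 < L p.1 then f p else 0 with hg
  have hsum : Summable g := by
    rw [← summable_norm_iff, ← Finset.HasAntidiagonal.sigmaAntidiagonalEquivProd.summable_iff,
      Function.comp_def, summable_sigma_of_nonneg fun p => norm_nonneg _]
    refine ⟨fun n => (hasSum_fintype _).summable, ?_⟩
    refine Summable.of_nonneg_of_le (fun n => tsum_nonneg fun p => norm_nonneg _) (fun n => ?_) hf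
    rw [tsum_fintype, ← Finset.sum_coe_sort (Finset.HasAntidiagonal.antidiagonal n)]
    refine Finset.sum_le_sum fun p _ => ?_
    simp only [Finset.HasAntidiagonal.sigmaAntidiagonalEquivProd_apply, hg,
      Real.norm_eq_abs]
    split_ifs
    · exact le_rfl
    · simp
  refine ⟨∑' p, g p, ?_, ?_⟩
  · have h := hsum.hasSum.prod_fiberwise fun r => (hsum.prod_factor r).hasSum
    refine h.congr_fun fun r => ?_
    rw [tsum_eq_sum (s := Finset.range (L r)) fun m hm => if_neg (by simpa using hm)]
    exact Finset.sum_congr rfl fun m hm => (if_pos (Finset.mem_range.1 hm)).symm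
  · have h := (Finset.HasAntidiagonal.sigmaAntidiagonalEquivProd.hasSum_iff.2 hsum.hasSum).sigma
      fun n => hasSum_fintype _
    refine h.congr_fun fun n => ?_
    rw [← Finset.sum_coe_sort]
    rfl

theorem abs_ballot_le (n r : ℕ) : |ballot n r| ≤ (n + 1).choose r := by
  rcases r with _ | r
  · simp [ballot]
  · rw [ballot, Nat.choose_succ_succ' n, abs_le]
    push_cast
    have h1 : (0 : ℝ) ≤ n.choose r := by positivity
    have h2 : (0 : ℝ) ≤ n.choose (r + 1) := by positivity
    constructor <;> linarith

theorem doubleTerm_eq {α t : ℝ} (hα : 0 < α) (ht : 0 ≤ t) (lam mu : ℝ) {n r m : ℕ}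
    (h : r + m = n + 1) : doubleTerm α lam mu t r m
      = ballot n r * lam ^ r * mu ^ ((n : ℤ) - r) * poissonML α (lam + mu) t n := by
  have hn : (r : ℝ) + m = n + 1 := by exact_mod_cast h
  have hz : (m : ℤ) - 1 = n - r := by omega
  rw [doubleTerm, div_mul_choose_eq_ballot h, hn, hz, show α * ((n : ℝ) + 1) - α = α * n by ring,
    mul_assoc _ (t ^ _), rpow_mul_prabhakar hα ht]

theorem hasSum_doubleTerm {α lam mu t : ℝ} (hα : 0 < α) (hlam : 0 < lam) (hmu : 0 < mu)
    (ht : 0 ≤ t) (i k : ℕ) :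
    ∃ S, HasSum (fun r => ∑ m ∈ Finset.range (k + r + i + 1), doubleTerm α lam mu t r m) S ∧
      HasSum (fun n => (boundaryPart lam mu n ((k : ℤ) + i) - (1 - lam / mu) * (lam + mu) ^ n)
        * poissonML α (lam + mu) t n) S := by
  have h0 : doubleTerm α lam mu t 0 0 = 0 := by simp [doubleTerm]
  have hsum : Summable fun n => ∑ p ∈ Finset.HasAntidiagonal.antidiagonal n,
      |doubleTerm α lam mu t p.1 p.2| := by
    rw [← summable_nat_add_iff 1]
    have hs := (summable_pow_mul_abs_poissonML hα ht (add_pos hlam hmu).le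
      (add_pos hlam hmu).le).mul_left ((lam + mu) / mu)
    refine Summable.of_nonneg_of_le (fun n => Finset.sum_nonneg fun p _ => abs_nonneg _)
      (fun n => ?_) hs
    rw [← mul_assoc, div_mul_eq_mul_div, ← pow_succ', (Commute.all lam mu).add_pow',
      Finset.sum_div, Finset.sum_mul]
    refine Finset.sum_le_sum fun p hp => ?_
    have hp' := Finset.HasAntidiagonal.mem_antidiagonal.1 hp
    rw [doubleTerm_eq hα ht lam mu hp', abs_mul, abs_mul, abs_mul, abs_of_pos (pow_pos hlam _),
      abs_of_pos (zpow_pos hmu _), show (n : ℤ) - p.1 = p.2 - 1 by omega, zpow_sub_one₀ hmu.ne',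
      zpow_natCast, nsmul_eq_mul, ← div_eq_mul_inv]
    calc _ ≤ ((n + 1).choose p.1 : ℝ) * lam ^ p.1 * (mu ^ p.2 / mu)
          * |poissonML α (lam + mu) t n| := by
          have := abs_ballot_le n p.1
          gcongr
      _ = _ := by ring
  obtain ⟨S, h1, h2⟩ := hasSum_sum_range_of_summable_antidiagonal
    (f := fun p => doubleTerm α lam mu t p.1 p.2) (fun r => k + r + i + 1) hsum
  refine ⟨S, h1, ?_⟩
  rw [← hasSum_nat_add_iff' 1] at h2
  simp only [Finset.range_one, Finset.sum_singleton, Finset.Nat.antidiagonal_zero, h0, ite_self,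
    sub_zero] at h2
  refine h2.congr_fun fun n => ?_
  rw [boundaryPart, add_sub_cancel_left, Finset.sum_mul,
    Finset.Nat.sum_antidiagonal_eq_sum_range_succ_mk]
  refine Finset.sum_congr rfl fun r hr => ?_
  have hr' : r ≤ n + 1 := Nat.lt_succ_iff.1 (Finset.mem_range.1 hr)
  rw [ite_mul, zero_mul]
  refine if_congr ?_ ?_ rfl
  · omega
  · rw [doubleTerm_eq hα ht lam mu (Nat.add_sub_cancel' hr')]

theorem singleTerm_eq {α t : ℝ} (hα : 0 < α) (ht : 0 ≤ t) (lam mu : ℝ) {i k r n : ℕ}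
    (h : k + 2 * r = n + i) : singleTerm α lam mu t i k r
      = walkPart lam mu i n k * poissonML α (lam + mu) t n := by
  have hz : (k : ℤ) + 2 * r - i = n := by omega
  have hr : (k : ℝ) + 2 * r - i = n := by exact_mod_cast hz
  rw [singleTerm, hz, hr, show (k : ℤ) + r - i = n - r by omega, walkPart_of_eq lam mu h,
    mul_assoc _ (t ^ _), rpow_mul_prabhakar hα ht]
  simp only [intChoose, if_neg (not_lt.2 (Nat.cast_nonneg (α := ℤ) n)), Int.toNat_natCast]

theorem singleTerm_eq_zero (α lam mu t : ℝ) {i k r : ℕ} (h : k + 2 * r < i) :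
    singleTerm α lam mu t i k r = 0 := by
  simp [singleTerm, intChoose, show (k : ℤ) + 2 * r - i < 0 by omega]

theorem hasSum_singleTerm {α lam mu t S : ℝ} (hα : 0 < α) (ht : 0 ≤ t) {i k : ℕ}
    (h : HasSum (fun n => walkPart lam mu i n k * poissonML α (lam + mu) t n) S) :
    HasSum (fun r => singleTerm α lam mu t i k r) S := by
  -- Index both series by `q = n + i = k + 2 r`.
  set H : ℕ → ℝ := fun q =>
    if i ≤ q then walkPart lam mu i (q - i) k * poissonML α (lam + mu) t (q - i) else 0 with hH
  have h1 : HasSum H S := by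
    rw [← (add_left_injective i).hasSum_iff]
    · refine h.congr_fun fun n => ?_
      simp [hH]
    · intro q hq
      exact if_neg fun hi => hq ⟨q - i, Nat.sub_add_cancel hi⟩
  have hinj : Function.Injective fun r : ℕ => k + 2 * r := fun a b hab => by
    simp only at hab
    omega
  rw [← hinj.hasSum_iff] at h1
  · refine h1.congr_fun fun r => ?_
    simp only [hH, Function.comp_apply]
    split_ifs with hi
    · exact singleTerm_eq hα ht lam mu (by omega)
    · exact singleTerm_eq_zero α lam mu t (by omega)
  · intro q hq
    simp only [hH]
    split_ifs with hi
    · rw [walkPart_of_ne lam mu fun r hr => hq ⟨r, by simp only; omega⟩, zero_mul]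
    · rfl

theorem abs_jump_pow_le {lam mu : ℝ} (hlam : 0 < lam) (hmu : 0 < mu) {v : ℕ → ℝ}
    (hv : ∀ k, |v k| ≤ 1) (n k : ℕ) : |(jump lam mu ^ n) v k| ≤ (2 * (lam + mu)) ^ n := by
  induction n generalizing k with
  | zero => simpa using hv k
  | succ n ih =>
    rw [pow_succ', Module.End.mul_apply, pow_succ']
    generalize (jump lam mu ^ n) v = w at ih ⊢
    have hB : 0 ≤ (2 * (lam + mu)) ^ n := by positivity
    generalize (2 * (lam + mu)) ^ n = B at ih hB ⊢
    have ih' := fun k => abs_le.1 (ih k)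
    rcases k with _ | k
    · rw [jump_apply_zero, abs_le]
      constructor <;> nlinarith [ih' 0, ih' 1, mul_nonneg hlam.le hB, mul_nonneg hmu.le hB]
    · rw [jump_apply_succ, abs_le]
      constructor <;> nlinarith [ih' k, ih' (k + 2), mul_nonneg hlam.le hB, mul_nonneg hmu.le hB]

/-- Uniformization: the state probabilities are mixtures of the `n`-step weights of the walk. -/
theorem hasSum_jump_pow_mul_poissonML {Ω : Type*} [MeasurableSpace Ω] {P : Measure Ω}
    [IsProbabilityMeasure P] {N : ℝ≥0 → Ω → ℕ} {α lam mu : ℝ} {i : ℕ} (hα : 0 < α) (hα1 : α ≤ 1)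
    (hlam : 0 < lam) (hmu : 0 < mu) (hN : IsFractionalMM1Queue α lam mu i P N) (k : ℕ) {t : ℝ}
    (ht : 0 ≤ t) :
    HasSum (fun n => (jump lam mu ^ n) (fun j => if j = i then 1 else 0) k
      * poissonML α (lam + mu) t n) (stateProb P N i k t) := by
  obtain ⟨S, h1, h2⟩ := exists_hasSum_mul_poissonML (K := 1) hα ht (add_pos hlam hmu).le
    (x := 2 * (lam + mu)) (by positivity)
    (w := fun n => (jump lam mu ^ n) (fun j => if j = i then 1 else 0) k) fun n => by
      rw [one_mul]
      refine abs_jump_pow_le hlam hmu (fun j => ?_) n k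
      split_ifs <;> simp
  simp only [← generator_pow_apply] at h2
  rwa [tendsto_nhds_unique h2.tendsto_sum_nat (tendsto_stateProb hα hα1 hlam hmu hN k ht)] at h1

theorem mainTheorem4 {Ω : Type*} [MeasurableSpace Ω] (P : Measure Ω) [IsProbabilityMeasure P]
    (N : ℝ≥0 → Ω → ℕ) (α lam mu : ℝ) (i : ℕ)
    (hα : 0 < α) (hα1 : α ≤ 1) (hlam : 0 < lam) (hmu : 0 < mu) (hne : lam ≠ mu)
    (hN : IsFractionalMM1Queue α lam mu i P N) (k : ℕ) (t : ℝ) (ht : 0 ≤ t) :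
    Summable (fun r : ℕ => ∑ m ∈ Finset.range (k + r + i + 1), doubleTerm α lam mu t r m) ∧
    Summable (fun r : ℕ => singleTerm α lam mu t i k r) ∧
    stateProb P N i k t =
      (1 - lam / mu) * (lam / mu) ^ k
      + (lam / mu) ^ k *
          ∑' r : ℕ, ∑ m ∈ Finset.range (k + r + i + 1), doubleTerm α lam mu t r m
      + ∑' r : ℕ, singleTerm α lam mu t i k r := by
  obtain ⟨S, hd, hb⟩ := hasSum_doubleTerm hα hlam hmu ht i k
  have hp := hasSum_jump_pow_mul_poissonML hα hα1 hlam hmu hN k ht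
  have h1 := hasSum_pow_mul_poissonML hα ht (add_pos hlam hmu).le
  have hw : HasSum (fun n => walkPart lam mu i n k * poissonML α (lam + mu) t n)
      (stateProb P N i k t - (1 - lam / mu) * (lam / mu) ^ k * 1 - (lam / mu) ^ k * S) := by
    refine ((hp.sub (h1.mul_left _)).sub (hb.mul_left _)).congr_fun fun n => ?_
    rw [jump_pow_apply hlam.ne' hmu.ne']
    ring
  have hs := hasSum_singleTerm hα ht hw
  refine ⟨hd.summable, hs.summable, ?_⟩
  rw [hd.tsum_eq, hs.tsum_eq]
  ring
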